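/- Let $C$ be a coalgebra over a field $k$, with comultiplication $\Delta$. Call a left (right) $C$-comodule distributive if its lattice of subcomodules is distributive, and call $C$ distributive if $C$ is distributive as a left or as a right comodule over itself. The quiver $\Gamma_C$ has the simple subcoalgebras of $C$ as vertices, and it has one arrow from $S_1$ to $S_2$ if $S_2\wedge S_1\neq S_1+S_2$ and none otherwise, where $U\wedge V=\Delta^{-1}(U\otimes C+C\otimes V)$. Proposition. Let $C$ be a distributive coalgebra. Then $\Gamma_C$ consists only of isolated vertices or loops, that is, there is no arrow in $\Gamma_C$ between distinct simple subcoalgebras. Likewise, in terms of comodules: if $S_1$ and $S_2$ are non-isomorphic simple left $C$-comodules, then there is no exact sequence $0\to S_1\to X\to S_2\to 0$ of left $C$-comodules with $X$ indecomposable; and the same holds for right $C$-comodules. -/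

import Mathlib

open scoped TensorProduct

universe u v w

/-! ## Comodules over a coalgebra -/

/-- A left comodule over a `k`-coalgebra `C`: a `k`-module `M` with a coassociative and counital
coaction `M → C ⊗ M`. -/
class LeftComodule (k C M : Type*) [Field k] [AddCommGroup C] [Module k C] [Coalgebra k C]
    [AddCommGroup M] [Module k M] where
  coact : M →ₗ[k] C ⊗[k] M
  coassoc : (TensorProduct.assoc k C C M).toLinearMap ∘ₗ
      (Coalgebra.comul (R := k) (A := C)).rTensor M ∘ₗ coact = coact.lTensor C ∘ₗ coact
  counit_coact : (Coalgebra.counit (R := k) (A := C)).rTensor M ∘ₗ coact =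
      TensorProduct.mk k k M 1

/-- A right comodule over a `k`-coalgebra `C`: a `k`-module `M` with a coassociative and counital
coaction `M → M ⊗ C`. -/
class RightComodule (k C M : Type*) [Field k] [AddCommGroup C] [Module k C] [Coalgebra k C]
    [AddCommGroup M] [Module k M] where
  coact : M →ₗ[k] M ⊗[k] C
  coassoc : (TensorProduct.assoc k M C C).toLinearMap ∘ₗ coact.rTensor C ∘ₗ coact =
      (Coalgebra.comul (R := k) (A := C)).lTensor M ∘ₗ coact
  counit_coact : (Coalgebra.counit (R := k) (A := C)).lTensor M ∘ₗ coact =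
      (TensorProduct.mk k M k).flip 1

namespace LeftComodule

variable (k C : Type*) [Field k] [AddCommGroup C] [Module k C] [Coalgebra k C]

/-- A coalgebra is a left comodule over itself. -/
instance self : LeftComodule k C C where
  coact := Coalgebra.comul
  coassoc := Coalgebra.coassoc
  counit_coact := Coalgebra.rTensor_counit_comp_comul

/-- `N` is a left subcomodule of `M`: the coaction maps `N` into `C ⊗ N`. -/
def IsSubcomodule {M : Type*} [AddCommGroup M] [Module k M] [LeftComodule k C M]
    (N : Submodule k M) : Prop :=
  N.map (coact : M →ₗ[k] C ⊗[k] M) ≤ LinearMap.range (N.subtype.lTensor C)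

/-- `M` is distributive: its lattice of subcomodules is distributive. -/
def IsDistributive (M : Type*) [AddCommGroup M] [Module k M] [LeftComodule k C M] : Prop :=
  ∀ N K L : Submodule k M, IsSubcomodule k C N → IsSubcomodule k C K → IsSubcomodule k C L →
    N ⊓ (K ⊔ L) = (N ⊓ K) ⊔ (N ⊓ L)

/-- `M` is simple: it is nonzero and its only subcomodules are `0` and `M`. -/
def IsSimple (M : Type*) [AddCommGroup M] [Module k M] [LeftComodule k C M] : Prop :=
  Nontrivial M ∧ ∀ N : Submodule k M, IsSubcomodule k C N → N = ⊥ ∨ N = ⊤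

/-- `M` is indecomposable: it is nonzero and not a direct sum of two nonzero subcomodules. -/
def IsIndecomposable (M : Type*) [AddCommGroup M] [Module k M] [LeftComodule k C M] : Prop :=
  Nontrivial M ∧ ∀ N K : Submodule k M, IsSubcomodule k C N → IsSubcomodule k C K →
    IsCompl N K → N = ⊥ ∨ K = ⊥

/-- `f` is a morphism of left `C`-comodules. -/
def IsColinear {M N : Type*} [AddCommGroup M] [Module k M] [LeftComodule k C M]
    [AddCommGroup N] [Module k N] [LeftComodule k C N] (f : M →ₗ[k] N) : Prop :=
  (coact : N →ₗ[k] C ⊗[k] N) ∘ₗ f = f.lTensor C ∘ₗ (coact : M →ₗ[k] C ⊗[k] M)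

/-- `M` and `N` are isomorphic as left `C`-comodules. -/
def Iso (M N : Type*) [AddCommGroup M] [Module k M] [LeftComodule k C M]
    [AddCommGroup N] [Module k N] [LeftComodule k C N] : Prop :=
  ∃ e : M ≃ₗ[k] N, IsColinear k C e.toLinearMap

/-- The arrow relation of the Ext quiver of left comodules: there is an exact sequence
`0 → S → X → T → 0` of left `C`-comodules with `X` indecomposable. -/
def HasArrow (S T : Type w) [AddCommGroup S] [Module k S] [LeftComodule k C S]
    [AddCommGroup T] [Module k T] [LeftComodule k C T] : Prop :=
  ∃ (X : Type w) (_ : AddCommGroup X) (_ : Module k X) (_ : LeftComodule k C X)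
    (f : S →ₗ[k] X) (g : X →ₗ[k] T),
    IsIndecomposable k C X ∧ IsColinear k C f ∧ IsColinear k C g ∧
      Function.Injective f ∧ Function.Exact f g ∧ Function.Surjective g

end LeftComodule

namespace RightComodule

variable (k C : Type*) [Field k] [AddCommGroup C] [Module k C] [Coalgebra k C]

/-- A coalgebra is a right comodule over itself. -/
instance self : RightComodule k C C where
  coact := Coalgebra.comul
  coassoc := Coalgebra.coassoc
  counit_coact := Coalgebra.lTensor_counit_comp_comul

/-- `N` is a right subcomodule of `M`: the coaction maps `N` into `N ⊗ C`. -/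
def IsSubcomodule {M : Type*} [AddCommGroup M] [Module k M] [RightComodule k C M]
    (N : Submodule k M) : Prop :=
  N.map (coact : M →ₗ[k] M ⊗[k] C) ≤ LinearMap.range (N.subtype.rTensor C)

/-- `M` is distributive: its lattice of subcomodules is distributive. -/
def IsDistributive (M : Type*) [AddCommGroup M] [Module k M] [RightComodule k C M] : Prop :=
  ∀ N K L : Submodule k M, IsSubcomodule k C N → IsSubcomodule k C K → IsSubcomodule k C L →
    N ⊓ (K ⊔ L) = (N ⊓ K) ⊔ (N ⊓ L)

/-- `M` is simple: it is nonzero and its only subcomodules are `0` and `M`. -/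
def IsSimple (M : Type*) [AddCommGroup M] [Module k M] [RightComodule k C M] : Prop :=
  Nontrivial M ∧ ∀ N : Submodule k M, IsSubcomodule k C N → N = ⊥ ∨ N = ⊤

/-- `M` is indecomposable: it is nonzero and not a direct sum of two nonzero subcomodules. -/
def IsIndecomposable (M : Type*) [AddCommGroup M] [Module k M] [RightComodule k C M] : Prop :=
  Nontrivial M ∧ ∀ N K : Submodule k M, IsSubcomodule k C N → IsSubcomodule k C K →
    IsCompl N K → N = ⊥ ∨ K = ⊥

/-- `f` is a morphism of right `C`-comodules. -/
def IsColinear {M N : Type*} [AddCommGroup M] [Module k M] [RightComodule k C M]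
    [AddCommGroup N] [Module k N] [RightComodule k C N] (f : M →ₗ[k] N) : Prop :=
  (coact : N →ₗ[k] N ⊗[k] C) ∘ₗ f = f.rTensor C ∘ₗ (coact : M →ₗ[k] M ⊗[k] C)

/-- `M` and `N` are isomorphic as right `C`-comodules. -/
def Iso (M N : Type*) [AddCommGroup M] [Module k M] [RightComodule k C M]
    [AddCommGroup N] [Module k N] [RightComodule k C N] : Prop :=
  ∃ e : M ≃ₗ[k] N, IsColinear k C e.toLinearMap

/-- The arrow relation of the Ext quiver of right comodules: there is an exact sequence
`0 → S → X → T → 0` of right `C`-comodules with `X` indecomposable. -/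
def HasArrow (S T : Type w) [AddCommGroup S] [Module k S] [RightComodule k C S]
    [AddCommGroup T] [Module k T] [RightComodule k C T] : Prop :=
  ∃ (X : Type w) (_ : AddCommGroup X) (_ : Module k X) (_ : RightComodule k C X)
    (f : S →ₗ[k] X) (g : X →ₗ[k] T),
    IsIndecomposable k C X ∧ IsColinear k C f ∧ IsColinear k C g ∧
      Function.Injective f ∧ Function.Exact f g ∧ Function.Surjective g

end RightComodule

/-! ## Distributive coalgebras and the quiver of a coalgebra -/

namespace Coalgebra

variable (k C : Type*) [Field k] [AddCommGroup C] [Module k C] [Coalgebra k C]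

/-- A coalgebra is distributive if it is distributive as a left or as a right comodule over
itself. -/
def IsDistributive : Prop :=
  LeftComodule.IsDistributive k C C ∨ RightComodule.IsDistributive k C C

variable {k C}

/-- `D` is a subcoalgebra: `Δ(D) ⊆ D ⊗ D`. -/
def IsSubcoalgebra (D : Submodule k C) : Prop :=
  D.map (comul : C →ₗ[k] C ⊗[k] C) ≤ LinearMap.range (_root_.TensorProduct.map D.subtype D.subtype)

/-- `D` is a simple subcoalgebra: a nonzero subcoalgebra whose only subcoalgebras are `0`
and `D`. -/
def IsSimpleSubcoalgebra (D : Submodule k C) : Prop :=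
  IsSubcoalgebra D ∧ D ≠ ⊥ ∧ ∀ E : Submodule k C, IsSubcoalgebra E → E ≤ D → E = ⊥ ∨ E = D

/-- The wedge `U ∧ V`, i.e. the kernel of `C → C ⊗ C → C/U ⊗ C/V`; equivalently the preimage of
`U ⊗ C + C ⊗ V` under the comultiplication. -/
def wedge (U V : Submodule k C) : Submodule k C :=
  LinearMap.ker (_root_.TensorProduct.map U.mkQ V.mkQ ∘ₗ (comul : C →ₗ[k] C ⊗[k] C))

variable (k C)

/-- The vertices of the quiver of `C`: the simple subcoalgebras of `C`. -/
def QuiverVertex : Type _ := {S : Submodule k C // IsSimpleSubcoalgebra S}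

/-- The quiver of `C`: there is one arrow from `S` to `T` if `T ∧ S ≠ S + T`, and none
otherwise. -/
instance quiver : Quiver (QuiverVertex k C) where
  Hom S T := PLift (wedge T.1 S.1 ≠ S.1 ⊔ T.1)

end Coalgebra

open Module (Dual)

/-! The dual of $C$ acts on $C$ by $f\mapsto(f\otimes\mathrm{id})\Delta$ and
$f\mapsto(\mathrm{id}\otimes f)\Delta$. These actions commute; their stable subspaces are the left
and right subcomodules, and subspaces stable under both are the subcoalgebras. So each right
operator is an endomorphism of $C$ as a left comodule.

Distributivity enters only through a graph argument (`IsStable.eq_zero_of_distributive`): an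
endomorphism carrying $N$ into some $L$ with $N\cap L=0$ vanishes on $N$. Hence a simple
subcoalgebra is already simple as a one-sided comodule, and $T\wedge S=S+T$ for distinct simple
subcoalgebras (`wedge_eq_sup_of_distributive`).

For comodules, a coefficient map that is nonzero on the simple subobject embeds an indecomposable
extension $X$ into $C$. Each simple end generates a simple subcoalgebra. If these differ, $X$ lands
in their wedge, hence in their direct sum, and splits; if they coincide, a translation inside $C$
gives an isomorphism of the ends (`ComoduleAction.exists_equiv`). -/

/-- A subspace that is mapped into itself by every operator of a family. -/
def IsStable {k I M : Type*} [Field k] [AddCommGroup M] [Module k M] (a : I → M →ₗ[k] M)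
    (N : Submodule k M) : Prop :=
  ∀ i, ∀ x ∈ N, a i x ∈ N

/-- A nonzero stable subspace whose only stable subspaces are `0` and itself. -/
structure IsSimpleStable {k I M : Type*} [Field k] [AddCommGroup M] [Module k M]
    (a : I → M →ₗ[k] M) (N : Submodule k M) : Prop where
  stable : IsStable a N
  ne_bot : N ≠ ⊥
  eq_bot_or_eq : ∀ K : Submodule k M, IsStable a K → K ≤ N → K = ⊥ ∨ K = N

/-! ### Stable subspaces and the graph argument. -/

namespace IsStable

variable {k I M M' : Type*} [Field k] [AddCommGroup M] [Module k M] [AddCommGroup M'] [Module k M']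
  {a : I → M →ₗ[k] M} {b : I → M' →ₗ[k] M'}

theorem inf {N K : Submodule k M} (hN : IsStable a N) (hK : IsStable a K) :
    IsStable a (N ⊓ K) :=
  fun i x hx => ⟨hN i x hx.1, hK i x hx.2⟩

theorem bot : IsStable a (⊥ : Submodule k M) := by
  intro i x hx
  simp [(Submodule.mem_bot k).1 hx]

theorem iSup {ι : Sort*} {N : ι → Submodule k M} (hN : ∀ j, IsStable a (N j)) :
    IsStable a (⨆ j, N j) := by
  intro i
  change (⨆ j, N j) ≤ (⨆ j, N j).comap (a i)
  exact iSup_le fun j x hx => Submodule.mem_iSup_of_mem j (hN j i x hx)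

theorem map {N : Submodule k M} (hN : IsStable a N) {φ : M →ₗ[k] M'}
    (hφ : ∀ i x, φ (a i x) = b i (φ x)) : IsStable b (N.map φ) := by
  rintro i _ ⟨x, hx, rfl⟩
  exact ⟨a i x, hN i x hx, hφ i x⟩

theorem comap {N : Submodule k M'} (hN : IsStable b N) {φ : M →ₗ[k] M'}
    (hφ : ∀ i x, φ (a i x) = b i (φ x)) : IsStable a (N.comap φ) := by
  intro i x hx
  rw [Submodule.mem_comap, hφ]
  exact hN i _ hx

theorem ker {φ : M →ₗ[k] M'} (hφ : ∀ i x, φ (a i x) = b i (φ x)) :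
    IsStable a (LinearMap.ker φ) :=
  bot.comap hφ

/-- If the lattice of stable subspaces is distributive, an equivariant map vanishes on a stable
subspace which it sends into a stable subspace independent of it. -/
theorem eq_zero_of_distributive
    (hd : ∀ N K L : Submodule k M, IsStable a N → IsStable a K → IsStable a L →
      N ⊓ (K ⊔ L) = (N ⊓ K) ⊔ (N ⊓ L))
    {N L : Submodule k M} (hN : IsStable a N) (hL : IsStable a L) (hNL : N ⊓ L = ⊥)
    {φ : M →ₗ[k] M} (hφ : ∀ i x, φ (a i x) = a i (φ x)) (hNφ : ∀ x ∈ N, φ x ∈ L) :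
    ∀ x ∈ N, φ x = 0 := by
  intro x hx
  have hz : ∀ y, y ∈ N → y ∈ L → y = 0 := fun y h1 h2 => by
    have : y ∈ N ⊓ L := ⟨h1, h2⟩
    rwa [hNL, Submodule.mem_bot] at this
  -- The graph of `φ` on `N` lies in `N ⊔ L` and meets `L` trivially. Distributivity therefore
  -- forces it into `N`, so `φ x ∈ N ⊓ L`.
  have hG : IsStable a (N.map (LinearMap.id + φ)) := hN.map (by simp [hφ])
  have h := hd _ _ _ hG hN hL
  have hm : x + φ x ∈ N.map (LinearMap.id + φ) ⊓ (N ⊔ L) :=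
    ⟨⟨x, hx, by simp⟩, Submodule.add_mem_sup hx (hNφ x hx)⟩
  rw [h] at hm
  obtain ⟨y, ⟨-, hyN⟩, z, ⟨⟨n, hn, rfl⟩, hzL⟩, hyz⟩ := Submodule.mem_sup.1 hm
  simp only [LinearMap.add_apply, LinearMap.id_apply] at hzL hyz
  have hn0 : n = 0 := hz n hn (by simpa using L.sub_mem hzL (hNφ n hn))
  subst hn0
  refine hz _ ?_ (hNφ x hx)
  have : φ x = y - x := by
    rw [eq_sub_iff_add_eq, add_comm, ← hyz]; simp
  rw [this]
  exact N.sub_mem hyN hx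

end IsStable

/-! ### Separating subspaces by functionals. -/

section separation

variable {k C : Type*} [Field k] [AddCommGroup C] [Module k C]

theorem Submodule.mem_of_forall_dual {U : Submodule k C} {x : C}
    (h : ∀ f : Dual k C, (∀ y ∈ U, f y = 0) → f x = 0) : x ∈ U := by
  by_contra hx
  obtain ⟨f, hf, hU⟩ := Submodule.exists_dual_map_eq_bot_of_notMem hx inferInstance
  refine hf (h f fun y hy => ?_)
  have : f y ∈ U.map f := ⟨y, hy, rfl⟩
  rwa [hU, Submodule.mem_bot] at this

theorem eq_of_forall_dual {x y : C} (h : ∀ f : Dual k C, f x = f y) : x = y :=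
  (Module.forall_dual_apply_eq_zero_iff k (x - y)).1 (by simp [h]) |> sub_eq_zero.1

theorem exists_dual_extend {S T : Submodule k C} (hST : S ⊓ T = ⊥) (f : Dual k C) :
    ∃ e : Dual k C, (∀ x ∈ S, e x = f x) ∧ ∀ x ∈ T, e x = 0 := by
  have hinj : LinearMap.ker (T.mkQ ∘ₗ S.subtype) = ⊥ := by
    rw [LinearMap.ker_eq_bot']
    rintro ⟨x, hx⟩ h
    have hxT : x ∈ T := by simpa using h
    have : x ∈ S ⊓ T := ⟨hx, hxT⟩
    rw [hST, Submodule.mem_bot] at this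
    exact Subtype.ext this
  obtain ⟨g, hg⟩ := LinearMap.exists_leftInverse_of_injective _ hinj
  refine ⟨f ∘ₗ S.subtype ∘ₗ g ∘ₗ T.mkQ, fun x hx => ?_, fun x hx => ?_⟩
  · have := LinearMap.congr_fun hg ⟨x, hx⟩
    simp only [LinearMap.comp_apply, Submodule.subtype_apply, LinearMap.id_apply] at this
    simp only [LinearMap.comp_apply, this, Submodule.subtype_apply]
  · have : T.mkQ x = 0 := by simpa using hx
    simp only [LinearMap.comp_apply, this, map_zero]

end separation

/-! ### The two dual actions and their one-sided orbits. -/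

/-- The two actions of the linear dual of a coalgebra on the coalgebra,
`left f = (f ⊗ id) ∘ Δ` and `right f = (id ⊗ f) ∘ Δ`, with their formal properties. -/
structure DualActions (k C : Type*) [Field k] [AddCommGroup C] [Module k C] where
  counit : Dual k C
  left : Dual k C →ₗ[k] C →ₗ[k] C
  right : Dual k C →ₗ[k] C →ₗ[k] C
  counit_left : ∀ f x, counit (left f x) = f x
  counit_right : ∀ f x, counit (right f x) = f x
  apply_right : ∀ (f g : Dual k C) x, f (right g x) = g (left f x)
  commute : ∀ f g x, left f (right g x) = right g (left f x)
  finite_left : ∀ x, ∃ W : Submodule k C, FiniteDimensional k W ∧ ∀ f, left f x ∈ W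
  finite_right : ∀ x, ∃ W : Submodule k C, FiniteDimensional k W ∧ ∀ f, right f x ∈ W

namespace DualActions

variable {k C : Type*} [Field k] [AddCommGroup C] [Module k C] (D : DualActions k C)

/-- The dual actions of the co-opposite coalgebra. -/
@[simps] def symm : DualActions k C where
  counit := D.counit
  left := D.right
  right := D.left
  counit_left := D.counit_right
  counit_right := D.counit_left
  apply_right f g x := (D.apply_right g f x).symm
  commute f g x := (D.commute g f x).symm
  finite_left := D.finite_right
  finite_right := D.finite_left

theorem left_counit (x : C) : D.left D.counit x = x :=
  eq_of_forall_dual fun f => by rw [← D.symm_right, D.symm.apply_right]; exact D.counit_right f x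

/-- This is coassociativity: the composite of two operators is the operator of a convolution
product, which makes orbits stable. -/
theorem left_left (f g : Dual k C) (x : C) :
    D.left g (D.left f x) = D.left (f ∘ₗ D.right g) x :=
  eq_of_forall_dual fun h => by
    rw [← D.apply_right, ← D.commute, ← D.apply_right, ← D.apply_right]; rfl

/-- The left orbit of an element. -/
def orbit (x : C) : Submodule k C := LinearMap.range (D.left.flip x)

theorem self_mem_orbit (x : C) : x ∈ D.orbit x := ⟨D.counit, D.left_counit x⟩

theorem orbit_stable (x : C) : IsStable D.left (D.orbit x) := by
  rintro g _ ⟨f, rfl⟩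
  exact ⟨_, (D.left_left f g x).symm⟩

theorem orbit_le {x : C} {N : Submodule k C} (hN : IsStable D.left N) (hx : x ∈ N) :
    D.orbit x ≤ N := by
  rintro _ ⟨f, rfl⟩
  exact hN f x hx

theorem orbit_finite (x : C) : FiniteDimensional k (D.orbit x) := by
  obtain ⟨W, hW, h⟩ := D.finite_left x
  refine Submodule.finiteDimensional_of_le (S₂ := W) ?_
  rintro _ ⟨f, rfl⟩
  exact h f

/-- Every nonzero left stable subspace contains a finite-dimensional simple one. -/
theorem exists_isSimpleStable_le {N : Submodule k C} (hN : IsStable D.left N) (h0 : N ≠ ⊥) :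
    ∃ S ≤ N, FiniteDimensional k S ∧ IsSimpleStable D.left S := by
  obtain ⟨x, hx, hx0⟩ := N.ne_bot_iff.1 h0
  have hfin := D.orbit_finite x
  let P : Set (Submodule k C) := {S | IsStable D.left S ∧ S ≠ ⊥ ∧ S ≤ D.orbit x}
  have hP : P.Nonempty := ⟨D.orbit x, D.orbit_stable x,
    (Submodule.ne_bot_iff _).2 ⟨x, D.self_mem_orbit x, hx0⟩, le_rfl⟩
  obtain ⟨S, ⟨hS, hS0, hSx⟩, hmin⟩ := exists_minimalFor_of_wellFoundedLT (· ∈ P)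
    (fun S : Submodule k C => Module.finrank k S) hP
  have hSf : FiniteDimensional k S := Submodule.finiteDimensional_of_le hSx
  refine ⟨S, hSx.trans (D.orbit_le hN hx), hSf, hS, hS0, fun K hK hKS => ?_⟩
  by_cases hK0 : K = ⊥
  · exact Or.inl hK0
  · exact Or.inr (Submodule.eq_of_le_of_finrank_le hKS
      (hmin ⟨hK, hK0, hKS.trans hSx⟩ (Submodule.finrank_mono hKS)))

/-! ### Simple subcoalgebras and wedges. -/

/-- A simple subcoalgebra in terms of the dual actions. -/
structure IsSimpleBistable (S : Submodule k C) : Prop where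
  left : IsStable D.left S
  right : IsStable D.right S
  ne_bot : S ≠ ⊥
  eq_bot_or_eq : ∀ E : Submodule k C, IsStable D.left E → IsStable D.right E → E ≤ S →
    E = ⊥ ∨ E = S

variable {D}

theorem IsSimpleBistable.symm {S : Submodule k C} (hS : D.IsSimpleBistable S) :
    D.symm.IsSimpleBistable S :=
  ⟨hS.right, hS.left, hS.ne_bot, fun E h1 h2 => hS.eq_bot_or_eq E h2 h1⟩

theorem IsSimpleBistable.inf_eq_bot {S T : Submodule k C} (hS : D.IsSimpleBistable S)
    (hT : D.IsSimpleBistable T) (hST : S ≠ T) : S ⊓ T = ⊥ := by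
  have hl := hS.left.inf hT.left
  have hr := hS.right.inf hT.right
  rcases hS.eq_bot_or_eq _ hl hr inf_le_left with h | h
  · exact h
  rcases hT.eq_bot_or_eq _ hl hr inf_le_right with h' | h'
  · exact h'
  · exact absurd (h.symm.trans h') hST

variable (D)

/-- The wedge of two subspaces in terms of the dual actions. -/
def wedge (U V : Submodule k C) : Set C :=
  {x | ∀ f g : Dual k C, (∀ y ∈ U, f y = 0) → (∀ y ∈ V, g y = 0) → f (D.right g x) = 0}

theorem symm_wedge (U V : Submodule k C) : D.symm.wedge V U = D.wedge U V := by
  ext x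
  constructor <;> intro h f g hf hg
  · rw [D.apply_right]; exact h g f hg hf
  · rw [D.symm.apply_right]; exact h g f hg hf

variable {D}

theorem right_mem_of_mem_wedge {U V : Submodule k C} {x : C} (hx : x ∈ D.wedge U V)
    {g : Dual k C} (hg : ∀ y ∈ V, g y = 0) : D.right g x ∈ U :=
  Submodule.mem_of_forall_dual fun f hf => hx f g hf hg

theorem right_eq_zero {S : Submodule k C} (hS : IsStable D.left S) {g : Dual k C}
    (hg : ∀ y ∈ S, g y = 0) {x : C} (hx : x ∈ S) : D.right g x = 0 :=
  eq_of_forall_dual fun f => by rw [D.apply_right, hg _ (hS f x hx), map_zero]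

/-- In a left distributive coalgebra a simple subcoalgebra is simple as a left comodule. -/
theorem IsSimpleBistable.isSimpleStable
    (hd : ∀ N K L : Submodule k C, IsStable D.left N → IsStable D.left K → IsStable D.left L →
      N ⊓ (K ⊔ L) = (N ⊓ K) ⊔ (N ⊓ L))
    {T : Submodule k C} (hT : D.IsSimpleBistable T) : IsSimpleStable D.left T := by
  obtain ⟨S, hST, hfin, hS⟩ := D.exists_isSimpleStable_le hT.left hT.ne_bot
  have hright : IsStable D.right S := by
    intro f
    have hφ : ∀ g x, D.right f (D.left g x) = D.left g (D.right f x) :=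
      fun g x => (D.commute g f x).symm
    have hmap := hS.stable.map hφ
    -- The right translate of `S` either meets `S` trivially, and then the graph argument makes it
    -- zero, or contains `S`, and then finite dimension makes it equal to `S`. So `S` is right
    -- stable, hence a subcoalgebra.
    rcases hS.eq_bot_or_eq _ (hS.stable.inf hmap) inf_le_left with h | h
    · intro x hx
      rw [hS.stable.eq_zero_of_distributive hd hmap h hφ (fun y hy => ⟨y, hy, rfl⟩) x hx]
      exact S.zero_mem
    · have := Submodule.eq_of_le_of_finrank_le (inf_eq_left.1 h)
        (Submodule.finrank_map_le (D.right f) S)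
      intro x hx
      rw [this]
      exact ⟨x, hx, rfl⟩
  rcases hT.eq_bot_or_eq S hS.stable hright hST with h | h
  · exact absurd h hS.ne_bot
  · exact h ▸ hS

/-- Pick `ξ` vanishing on `S` but not on `T`. By Schur, `D.right ξ` is bijective on `T`, so an
element `x` of the wedge can be corrected by some `s ∈ T` to make `D.right ξ` kill `x - s`. The left
orbit of `x - s` then meets `T` trivially, while every `D.right g` with `g` vanishing on `S` sends
it into `T`. Distributivity makes these maps zero on the orbit, so every such `g` kills `x - s`,
which puts it in `S`. -/
theorem wedge_eq_sup_of_distributive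
    (hd : ∀ N K L : Submodule k C, IsStable D.left N → IsStable D.left K → IsStable D.left L →
      N ⊓ (K ⊔ L) = (N ⊓ K) ⊔ (N ⊓ L))
    {S T : Submodule k C} (hS : D.IsSimpleBistable S) (hT : D.IsSimpleBistable T) (hST : S ≠ T) :
    D.wedge T S ⊆ (S ⊔ T : Submodule k C) := by
  have hTs := hT.isSimpleStable hd
  have hinf := hS.inf_eq_bot hT hST
  have hcomm : ∀ f g x, D.right f (D.left g x) = D.left g (D.right f x) :=
    fun f g x => (D.commute g f x).symm
  obtain ⟨t, htT, ht0⟩ := T.ne_bot_iff.1 hT.ne_bot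
  obtain ⟨ξ, hξt, hξS⟩ : ∃ ξ : Dual k C, ξ t ≠ 0 ∧ ∀ y ∈ S, ξ y = 0 := by
    by_contra! h
    have htS : t ∈ S := Submodule.mem_of_forall_dual fun f hf => by
      by_contra h'
      obtain ⟨y, hy, hy0⟩ := h f h'
      exact hy0 (hf y hy)
    have : t ∈ S ⊓ T := ⟨htS, htT⟩
    rw [hinf, Submodule.mem_bot] at this
    exact ht0 this
  have hne : D.right ξ t ≠ 0 := fun h => hξt (by rw [← D.counit_right, h, map_zero])
  have hker : LinearMap.ker (D.right ξ) ⊓ T = ⊥ := by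
    rcases hTs.eq_bot_or_eq _ ((IsStable.ker (hcomm ξ)).inf hT.left) inf_le_right with h | h
    · exact h
    · exact absurd (inf_eq_right.1 h htT) hne
  have hsurj : T.map (D.right ξ) = T := by
    have hle : T.map (D.right ξ) ≤ T := by
      rintro _ ⟨y, hy, rfl⟩
      exact hT.right ξ y hy
    rcases hTs.eq_bot_or_eq _ (hT.left.map (hcomm ξ)) hle with h | h
    · refine absurd ?_ hne
      have : D.right ξ t ∈ T.map (D.right ξ) := ⟨t, htT, rfl⟩
      rwa [h, Submodule.mem_bot] at this
    · exact h
  intro x hx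
  have hxT := right_mem_of_mem_wedge hx hξS
  rw [← hsurj] at hxT
  obtain ⟨s, hsT, hs⟩ := hxT
  have hy0 : D.right ξ (x - s) = 0 := by rw [map_sub, hs, sub_self]
  have hyw : ∀ g : Dual k C, (∀ y ∈ S, g y = 0) → D.right g (x - s) ∈ T := fun g hg => by
    rw [map_sub]
    exact T.sub_mem (right_mem_of_mem_wedge hx hg) (hT.right g s hsT)
  have horb : D.orbit (x - s) ⊓ T = ⊥ := by
    refine le_bot_iff.1 (le_trans (inf_le_inf_right _ ?_) hker.le)
    exact D.orbit_le (IsStable.ker (hcomm ξ)) hy0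
  have hyS : x - s ∈ S := by
    refine Submodule.mem_of_forall_dual fun g hg => ?_
    rw [← D.counit_right, (D.orbit_stable (x - s)).eq_zero_of_distributive hd hT.left horb
      (hcomm g) ?_ _ (D.self_mem_orbit _), map_zero]
    rintro _ ⟨f, rfl⟩
    change D.right g (D.left f (x - s)) ∈ T
    rw [hcomm]
    exact hT.left f _ (hyw g hg)
  exact Submodule.mem_sup.2 ⟨x - s, hyS, s, hsT, sub_add_cancel x s⟩

theorem sup_le_wedge {S T : Submodule k C} (hS : D.IsSimpleBistable S)
    (hT : D.IsSimpleBistable T) {x : C} (hx : x ∈ S ⊔ T) : x ∈ D.wedge T S := by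
  obtain ⟨s, hs, t, ht, rfl⟩ := Submodule.mem_sup.1 hx
  intro f g hf hg
  rw [map_add, map_add, right_eq_zero hS.left hg hs, hf _ (hT.right g t ht), map_zero, add_zero]

variable (D)

/-! ### The subcoalgebra generated by a simple right subcomodule. -/

/-- The subspace generated by a subspace under the left action. -/
def saturate (S : Submodule k C) : Submodule k C := ⨆ f, S.map (D.left f)

theorem left_mem_saturate {S : Submodule k C} (f : Dual k C) {x : C} (hx : x ∈ S) :
    D.left f x ∈ D.saturate S :=
  Submodule.mem_iSup_of_mem f ⟨x, hx, rfl⟩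

theorem le_saturate (S : Submodule k C) : S ≤ D.saturate S := fun x hx => by
  have := D.left_mem_saturate D.counit hx
  rwa [left_counit] at this

theorem saturate_le {S E : Submodule k C} (hE : IsStable D.left E) (h : S ≤ E) :
    D.saturate S ≤ E := by
  refine iSup_le fun f => ?_
  rintro _ ⟨x, hx, rfl⟩
  exact hE f x (h hx)

theorem saturate_left (S : Submodule k C) : IsStable D.left (D.saturate S) := by
  intro g
  change D.saturate S ≤ (D.saturate S).comap (D.left g)
  refine iSup_le fun f => ?_
  rintro _ ⟨x, hx, rfl⟩
  rw [Submodule.mem_comap, left_left]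
  exact D.left_mem_saturate _ hx

theorem saturate_right {S : Submodule k C} (hS : IsStable D.right S) :
    IsStable D.right (D.saturate S) :=
  IsStable.iSup fun f => hS.map (D.commute f)

variable {D}

/-- A nonzero element of the saturation of a simple right stable subspace `S` can be moved to a
nonzero element of `S` by the left action. -/
theorem exists_left_mem {S : Submodule k C} (hS : IsSimpleStable D.right S) {y : C}
    (hy : y ∈ D.saturate S) (hy0 : y ≠ 0) : ∃ f, D.left f y ∈ S ∧ D.left f y ≠ 0 := by
  classical
  obtain ⟨F, hF⟩ := Submodule.mem_iSup_iff_exists_finset.1 hy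
  clear hy
  induction F using Finset.induction_on with
  | empty => simp [hy0] at hF
  | insert f F _ ih =>
    rw [Finset.iSup_insert] at hF
    obtain ⟨_, ⟨s, hs, rfl⟩, z, hz, hsz⟩ := Submodule.mem_sup.1 hF
    -- `J` collects the right translates of `s` by functionals annihilating `y`. If it is zero,
    -- duality puts `s` in the left orbit of `y`. If it is `S`, some `g` fixes `s` and kills `y`,
    -- which cancels the `f` summand and leaves `y` in the shorter sum.
    let J : Submodule k C := (LinearMap.ker (D.right.flip y)).map (D.right.flip s)
    have hJ : IsStable D.right J := by
      rintro h _ ⟨g, hg, rfl⟩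
      have hg' : D.right g y = 0 := hg
      -- The convolution formula of `left_left`, read for the exchanged actions.
      refine ⟨g ∘ₗ D.left h, ?_, (D.symm.left_left g h s).symm⟩
      change D.right (g ∘ₗ D.left h) y = 0
      have := D.symm.left_left g h y
      simp only [symm_left, symm_right] at this
      rw [← this, hg', map_zero]
    have hJS : J ≤ S := by
      rintro _ ⟨g, -, rfl⟩
      exact hS.stable g s hs
    rcases hS.eq_bot_or_eq J hJ hJS with h | h
    · by_cases hs0 : s = 0
      · refine ih ?_
        rw [← hsz, hs0, map_zero, zero_add]
        exact hz
      · have hmem : s ∈ D.orbit y := by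
          refine Submodule.mem_of_forall_dual fun g hg => ?_
          have hgy : D.right g y = 0 :=
            right_eq_zero (D.orbit_stable y) hg (D.self_mem_orbit y)
          have hgs : D.right g s ∈ J := ⟨g, hgy, rfl⟩
          rw [h, Submodule.mem_bot] at hgs
          rw [← D.counit_right, hgs, map_zero]
        obtain ⟨g, rfl⟩ := hmem
        exact ⟨g, hs, hs0⟩
    · obtain ⟨g, hg, hgs⟩ : s ∈ J := h ▸ hs
      have hgy : D.right g y = 0 := hg
      have hgs : D.right g s = s := hgs
      refine ih ?_
      have hzy : y = z - D.right g z := by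
        have h1 : D.right g y = D.left f s + D.right g z := by
          rw [← hsz, map_add, ← D.commute, hgs]
        rw [hgy] at h1
        rw [← hsz, eq_neg_of_add_eq_zero_left h1.symm]
        abel
      rw [hzy]
      refine Submodule.sub_mem _ hz (?_ : D.right g z ∈ _)
      exact IsStable.iSup (fun f => IsStable.iSup fun _ => hS.stable.map (D.commute f)) g z hz

/-- A nonzero subcoalgebra `E` of the saturation contains, after a left translation, a nonzero
element of `S`. Simplicity of `S` gives `S ≤ E`, and left stability then gives the whole saturation.
-/
theorem saturate_isSimpleBistable {S : Submodule k C} (hS : IsSimpleStable D.right S) :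
    D.IsSimpleBistable (D.saturate S) where
  left := D.saturate_left S
  right := D.saturate_right hS.stable
  ne_bot h := hS.ne_bot (le_bot_iff.1 (h ▸ D.le_saturate S))
  eq_bot_or_eq E hl hr hE := by
    by_cases h0 : E = ⊥
    · exact Or.inl h0
    refine Or.inr (le_antisymm hE (D.saturate_le hl ?_))
    obtain ⟨y, hy, hy0⟩ := E.ne_bot_iff.1 h0
    obtain ⟨f, hf, hf0⟩ := exists_left_mem hS (hE hy) hy0
    rcases hS.eq_bot_or_eq _ (hS.stable.inf hr) inf_le_left with h | h
    · refine absurd ?_ hf0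
      rw [← Submodule.mem_bot k, ← h]
      exact ⟨hf, hl f y hy⟩
    · exact inf_eq_left.1 h

/-! ### Extensions of simple comodules embedded in the coalgebra. -/

/-- The action of the dual of a coalgebra on a right comodule together with the coefficient maps
of the comodule. -/
structure ComoduleAction (D : DualActions k C) (M : Type*) [AddCommGroup M] [Module k M] where
  act : Dual k C →ₗ[k] M →ₗ[k] M
  coeff : Dual k M → M →ₗ[k] C
  counit_coeff : ∀ ξ m, D.counit (coeff ξ m) = ξ m
  apply_coeff : ∀ (f : Dual k C) ξ m, f (coeff ξ m) = ξ (act f m)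
  coeff_act : ∀ ξ f m, coeff ξ (act f m) = D.right f (coeff ξ m)

theorem IsSimpleStable.of_injective {M M' I : Type*} [AddCommGroup M] [Module k M]
    [AddCommGroup M'] [Module k M'] {a : I → M →ₗ[k] M} {b : I → M' →ₗ[k] M'}
    (hM : IsSimpleStable a ⊤) {φ : M →ₗ[k] M'} (hφ : ∀ i x, φ (a i x) = b i (φ x))
    (hinj : Function.Injective φ) : IsSimpleStable b (LinearMap.range φ) where
  stable := by rw [LinearMap.range_eq_map]; exact hM.stable.map hφ
  ne_bot h := hM.ne_bot (by
    rw [← LinearMap.ker_eq_bot.2 hinj, LinearMap.range_eq_bot.1 h, LinearMap.ker_zero])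
  eq_bot_or_eq K hK hKφ := by
    have h : (K.comap φ).map φ = K := Submodule.map_comap_eq_of_le hKφ
    rcases hM.eq_bot_or_eq _ (hK.comap hφ) le_top with h' | h'
    · left; rw [← h, h', Submodule.map_bot]
    · right; rw [← h, h', LinearMap.range_eq_map]

theorem IsSimpleStable.injective {M M' I : Type*} [AddCommGroup M] [Module k M]
    [AddCommGroup M'] [Module k M'] {a : I → M →ₗ[k] M} {b : I → M' →ₗ[k] M'}
    (hM : IsSimpleStable a ⊤) {φ : M →ₗ[k] M'} (hφ : ∀ i x, φ (a i x) = b i (φ x))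
    {x : M} (hx : φ x ≠ 0) : Function.Injective φ := by
  rw [← LinearMap.ker_eq_bot]
  rcases hM.eq_bot_or_eq _ (IsStable.ker hφ) le_top with h | h
  · exact h
  · exact absurd (show x ∈ LinearMap.ker φ from h ▸ trivial) hx

/-- If distinct simple subcoalgebras are not linked, the ends of a short exact sequence of
comodules with simple ends and indecomposable middle term are isomorphic. -/
theorem ComoduleAction.exists_equiv
    (hw : ∀ S T : Submodule k C, D.IsSimpleBistable S → D.IsSimpleBistable T → S ≠ T →
      D.wedge S T ⊆ (S ⊔ T : Submodule k C))
    {S X T : Type*} [AddCommGroup S] [Module k S] [AddCommGroup X] [Module k X]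
    [AddCommGroup T] [Module k T] (aS : ComoduleAction D S) (aX : ComoduleAction D X)
    (aT : ComoduleAction D T) (hS : IsSimpleStable aS.act ⊤) (hT : IsSimpleStable aT.act ⊤)
    (hX : ∀ N K : Submodule k X, IsStable aX.act N → IsStable aX.act K → IsCompl N K →
      N = ⊥ ∨ K = ⊥)
    {f : S →ₗ[k] X} {g : X →ₗ[k] T} (hf : ∀ i x, f (aS.act i x) = aX.act i (f x))
    (hg : ∀ i x, g (aX.act i x) = aT.act i (g x)) (hfi : Function.Injective f)
    (hfg : Function.Exact f g) (hgs : Function.Surjective g) :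
    ∃ e : S ≃ₗ[k] T, ∀ i x, e (aS.act i x) = aT.act i (e x) := by
  obtain ⟨s₀, -, hs₀⟩ := (Submodule.ne_bot_iff _).1 hS.ne_bot
  obtain ⟨t₀, -, ht₀⟩ := (Submodule.ne_bot_iff _).1 hT.ne_bot
  obtain ⟨ξ, hξ⟩ : ∃ ξ : Dual k X, ξ (f s₀) ≠ 0 := by
    by_contra! h
    exact hs₀ (hfi (by rw [map_zero, ← Module.forall_dual_apply_eq_zero_iff k]; exact h))
  obtain ⟨ζ, hζ⟩ : ∃ ζ : Dual k T, ζ t₀ ≠ 0 := by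
    by_contra! h
    exact ht₀ ((Module.forall_dual_apply_eq_zero_iff k _).1 h)
  have hj := aX.coeff_act ξ
  have hι := aT.coeff_act ζ
  have hjf : ∀ i x, (aX.coeff ξ ∘ₗ f) (aS.act i x) = D.right i ((aX.coeff ξ ∘ₗ f) x) :=
    fun i x => by simp only [LinearMap.comp_apply, hf, hj]
  have hjfi : Function.Injective (aX.coeff ξ ∘ₗ f) :=
    IsSimpleStable.injective hS hjf (x := s₀)
      (fun h => hξ (by rw [← aX.counit_coeff]; simp_all))
  have hιi : Function.Injective (aT.coeff ζ) :=
    IsSimpleStable.injective hT hι (x := t₀)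
      (fun h => hζ (by rw [← aT.counit_coeff, h, map_zero]))
  have hrange : IsStable aX.act (LinearMap.range f) := by
    rw [LinearMap.range_eq_map]; exact hS.stable.map hf
  have hf0 : LinearMap.range f ≠ ⊥ :=
    (Submodule.ne_bot_iff _).2 ⟨f s₀, ⟨s₀, rfl⟩, fun h => hξ (by rw [h, map_zero])⟩
  -- The kernel meets the image of `S` trivially. If it mapped onto `T` it would be a complement of
  -- that image, hence zero by indecomposability; otherwise it maps to zero and lies in the image of
  -- `S`.
  have hji : Function.Injective (aX.coeff ξ) := by
    rw [← LinearMap.ker_eq_bot]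
    have hdisj : Disjoint (LinearMap.range f) (LinearMap.ker (aX.coeff ξ)) := by
      rw [Submodule.disjoint_def]
      rintro _ ⟨s, rfl⟩ h
      rw [hjfi (a₁ := s) (a₂ := 0) (by simpa using h), map_zero]
    have hKs : IsStable aX.act (LinearMap.ker (aX.coeff ξ)) := IsStable.ker hj
    rcases hT.eq_bot_or_eq _ (hKs.map hg) le_top with h | h
    · refine le_bot_iff.1 fun x hx => ?_
      have hgx : g x = 0 := by
        rw [← Submodule.mem_bot k, ← h]; exact ⟨x, hx, rfl⟩
      exact (Submodule.mem_bot k).2 (Submodule.disjoint_def.1 hdisj x ((hfg x).1 hgx) hx)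
    · refine (hX _ _ hrange hKs ⟨hdisj, codisjoint_iff.2 (eq_top_iff.2 fun x _ => ?_)⟩).resolve_left
        hf0
      obtain ⟨y, hy, hyx⟩ : g x ∈ (LinearMap.ker (aX.coeff ξ)).map g := h ▸ trivial
      refine Submodule.mem_sup.2 ⟨x - y, (hfg _).1 ?_, y, hy, sub_add_cancel x y⟩
      rw [map_sub, hyx, sub_self]
  have hS' := IsSimpleStable.of_injective hS hjf hjfi
  have hT' := IsSimpleStable.of_injective hT hι hιi
  have hSs := saturate_isSimpleBistable hS'
  have hTs := saturate_isSimpleBistable hT'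
  generalize hS'' : LinearMap.range (aX.coeff ξ ∘ₗ f) = S' at *
  generalize hT'' : LinearMap.range (aT.coeff ζ) = T' at *
  have hTmem : ∀ t, aT.coeff ζ t ∈ D.saturate T' :=
    fun t => D.le_saturate T' (hT'' ▸ ⟨t, rfl⟩)
  by_cases hST : D.saturate S' = D.saturate T'
  · have hy0 : aT.coeff ζ t₀ ≠ 0 := fun h => ht₀ (hιi (by rw [h, map_zero]))
    -- Left translation by `p` commutes with the right action, so it carries the copy of `T` onto
    -- the copy of `S` in `C`.
    obtain ⟨p, hp, hp0⟩ := exists_left_mem hS' (hST ▸ hTmem t₀) hy0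
    have hψ : ∀ i x, (D.left p ∘ₗ aT.coeff ζ) (aT.act i x) =
        D.right i ((D.left p ∘ₗ aT.coeff ζ) x) :=
      fun i x => by simp only [LinearMap.comp_apply, hι, D.commute]
    have hψi : Function.Injective (D.left p ∘ₗ aT.coeff ζ) :=
      IsSimpleStable.injective hT hψ (x := t₀) hp0
    have hψr : LinearMap.range (D.left p ∘ₗ aT.coeff ζ) = S' := by
      have hst := (IsSimpleStable.of_injective hT hψ hψi)
      have hmem : D.left p (aT.coeff ζ t₀) ∈ LinearMap.range (D.left p ∘ₗ aT.coeff ζ) ⊓ S' :=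
        ⟨⟨t₀, rfl⟩, hp⟩
      have hin := hst.stable.inf hS'.stable
      have hnb := (Submodule.ne_bot_iff _).2 ⟨_, hmem, hp0⟩
      exact ((hst.eq_bot_or_eq _ hin inf_le_left).resolve_left hnb).symm.trans
        ((hS'.eq_bot_or_eq _ hin inf_le_right).resolve_left hnb)
    let e : S ≃ₗ[k] T := (LinearEquiv.ofInjective _ hjfi).trans
      ((LinearEquiv.ofEq _ _ (hS''.trans hψr.symm)).trans (LinearEquiv.ofInjective _ hψi).symm)
    have he : ∀ s, (D.left p ∘ₗ aT.coeff ζ) (e s) = (aX.coeff ξ ∘ₗ f) s := by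
      intro s
      have := congrArg Subtype.val (LinearEquiv.apply_symm_apply (LinearEquiv.ofInjective _ hψi)
        (LinearEquiv.ofEq _ _ (hS''.trans hψr.symm) (LinearEquiv.ofInjective _ hjfi s)))
      exact this
    exact ⟨e, fun i x => hψi (by rw [he, hjf, hψ, he])⟩
  · exfalso
    have hdisj := hSs.inf_eq_bot hTs hST
    -- A functional vanishing on the subcoalgebra of `T` acts as zero on `T`, so it moves `X` into
    -- the image of `S`: this is the wedge condition.
    have hsup : ∀ x, aX.coeff ξ x ∈ D.saturate S' ⊔ D.saturate T' := by
      refine fun x => hw _ _ hSs hTs hST fun p q hp hq => ?_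
      have hq0 : ∀ t, aT.act q t = 0 := fun t => hιi (by
        rw [hι, map_zero, right_eq_zero hTs.left hq (hTmem t)])
      obtain ⟨s, hs⟩ := (hfg (aX.act q x)).1 (by rw [hg, hq0])
      rw [← hj, ← hs]
      exact hp _ (D.le_saturate S' (hS'' ▸ ⟨s, rfl⟩))
    -- Acting by this functional, the counit on one summand and zero on the other, is the projection
    -- that splits `X`.
    obtain ⟨e, heS, heT⟩ := exists_dual_extend hdisj D.counit
    have hreS : ∀ x ∈ D.saturate S', D.right e x = x := fun x hx =>
      eq_of_forall_dual fun h => by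
        rw [D.apply_right, heS _ (hSs.left h x hx), D.counit_left]
    have hall : ∀ x, aX.coeff ξ x ∈ D.saturate S' := by
      have hcompl : IsCompl ((D.saturate S').comap (aX.coeff ξ))
          ((D.saturate T').comap (aX.coeff ξ)) := by
        constructor
        · rw [Submodule.disjoint_def]
          intro x h1 h2
          refine hji ?_
          rw [map_zero, ← Submodule.mem_bot k, ← hdisj]
          exact ⟨h1, h2⟩
        · rw [codisjoint_iff, eq_top_iff]
          intro x _
          obtain ⟨s, hs, t, ht, hst⟩ := Submodule.mem_sup.1 (hsup x)
          have hes : aX.coeff ξ (aX.act e x) = s := by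
            rw [hj, ← hst, map_add, hreS s hs, right_eq_zero hTs.left heT ht, add_zero]
          refine Submodule.mem_sup.2 ⟨aX.act e x, ?_, x - aX.act e x, ?_, add_sub_cancel _ _⟩
          · rw [Submodule.mem_comap, hes]; exact hs
          · rw [Submodule.mem_comap, map_sub, hes, ← hst, add_sub_cancel_left]; exact ht
      have hK := (hX _ _ (hSs.right.comap hj) (hTs.right.comap hj) hcompl).resolve_left
        ((Submodule.ne_bot_iff _).2 ⟨f s₀, D.le_saturate S' (hS'' ▸ ⟨s₀, rfl⟩),
          fun h => hξ (by rw [h, map_zero])⟩)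
      rw [hK] at hcompl
      have htop := eq_top_of_isCompl_bot hcompl
      exact fun x => (htop ▸ trivial : x ∈ (D.saturate S').comap (aX.coeff ξ))
    -- Functionals vanishing on the first subcoalgebra now annihilate `X`, hence its quotient `T`,
    -- so the coefficients of `T` lie in both subcoalgebras.
    have hgx : ∀ x, aT.coeff ζ (g x) ∈ D.saturate S' := fun x =>
      Submodule.mem_of_forall_dual fun q hq => by
        have : aX.act q x = 0 := hji (by
          rw [hj, map_zero, right_eq_zero hSs.left hq (hall x)])
        rw [aT.apply_coeff, ← hg, this, map_zero, map_zero]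
    obtain ⟨x, rfl⟩ := hgs t₀
    have h0 : aT.coeff ζ (g x) ∈ D.saturate S' ⊓ D.saturate T' := ⟨hgx x, hTmem _⟩
    rw [hdisj, Submodule.mem_bot] at h0
    exact ht₀ (hιi (by rw [h0, map_zero]))

end DualActions

/-! ### Contracting tensors with functionals. -/

namespace TensorProduct

variable {k C M N : Type*} [Field k] [AddCommGroup C] [Module k C] [AddCommGroup M] [Module k M]
  [AddCommGroup N] [Module k N]

/-- Contraction of the first tensor factor with a functional. -/
def contractFst (M : Type*) [AddCommGroup M] [Module k M] (f : Dual k C) : C ⊗[k] M →ₗ[k] M :=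
  (TensorProduct.lid k M).toLinearMap ∘ₗ f.rTensor M

/-- Contraction of the second tensor factor with a functional. -/
def contractSnd (M : Type*) [AddCommGroup M] [Module k M] (f : Dual k C) : M ⊗[k] C →ₗ[k] M :=
  (TensorProduct.rid k M).toLinearMap ∘ₗ f.lTensor M

@[simp] theorem contractFst_tmul (f : Dual k C) (c : C) (m : M) :
    contractFst M f (c ⊗ₜ m) = f c • m := by
  simp [contractFst]

@[simp] theorem contractSnd_tmul (f : Dual k C) (c : C) (m : M) :
    contractSnd M f (m ⊗ₜ c) = f c • m := by
  simp [contractSnd]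

theorem contractFst_add (f g : Dual k C) :
    contractFst M (f + g) = contractFst M f + contractFst M g := by
  ext; simp [add_smul]

theorem contractFst_smul (r : k) (f : Dual k C) :
    contractFst M (r • f) = r • contractFst M f := by
  ext; simp [mul_smul]

theorem contractSnd_add (f g : Dual k C) :
    contractSnd M (f + g) = contractSnd M f + contractSnd M g := by
  ext; simp [add_smul]

theorem contractSnd_smul (r : k) (f : Dual k C) :
    contractSnd M (r • f) = r • contractSnd M f := by
  ext; simp [mul_smul]

theorem contractSnd_eq_contractFst_comm (f : Dual k C) (z : M ⊗[k] C) :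
    contractSnd M f z = contractFst M f (TensorProduct.comm k M C z) := by
  induction z with
  | zero => simp
  | add x y hx hy => simp only [map_add, hx, hy]
  | tmul m c => simp

theorem eq_zero_of_contractFst {z : C ⊗[k] M} (h : ∀ f : Dual k C, contractFst M f z = 0) :
    z = 0 := by
  classical
  let b := Module.Basis.ofVectorSpace k C
  have key : ∀ (w : C ⊗[k] M) i,
      TensorProduct.equivFinsuppOfBasisLeft (N := M) b w i = contractFst M (b.coord i) w := by
    intro w i
    induction w with
    | zero => simp
    | add x y hx hy => simp only [map_add, Finsupp.add_apply, hx, hy]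
    | tmul c m => simp
  apply (TensorProduct.equivFinsuppOfBasisLeft (M := C) (N := M) b).injective
  ext i
  rw [key, h, map_zero, Finsupp.zero_apply]

theorem eq_of_contractFst {z z' : C ⊗[k] M}
    (h : ∀ f : Dual k C, contractFst M f z = contractFst M f z') : z = z' :=
  sub_eq_zero.1 (eq_zero_of_contractFst fun f => by rw [map_sub, h, sub_self])

theorem eq_of_contractSnd {z z' : M ⊗[k] C}
    (h : ∀ f : Dual k C, contractSnd M f z = contractSnd M f z') : z = z' :=
  (TensorProduct.comm k M C).injective
    (eq_of_contractFst fun f => by simpa only [contractSnd_eq_contractFst_comm] using h f)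

theorem contractFst_lTensor (f : Dual k C) (φ : M →ₗ[k] N) (z : C ⊗[k] M) :
    contractFst N f (φ.lTensor C z) = φ (contractFst M f z) := by
  induction z with
  | zero => simp
  | add x y hx hy => simp only [map_add, hx, hy]
  | tmul c m => simp

theorem contractSnd_rTensor (f : Dual k C) (φ : M →ₗ[k] N) (z : M ⊗[k] C) :
    contractSnd N f (φ.rTensor C z) = φ (contractSnd M f z) := by
  induction z with
  | zero => simp
  | add x y hx hy => simp only [map_add, hx, hy]
  | tmul c m => simp

theorem apply_contractFst (f : Dual k C) (g : Dual k M) (z : C ⊗[k] M) :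
    g (contractFst M f z) = f (contractSnd C g z) := by
  induction z with
  | zero => simp
  | add x y hx hy => simp only [map_add, hx, hy]
  | tmul c m => simp [mul_comm]

theorem mem_range_lTensor_iff (N : Submodule k M) (z : C ⊗[k] M) :
    z ∈ LinearMap.range (N.subtype.lTensor C) ↔ ∀ f : Dual k C, contractFst M f z ∈ N := by
  have hex := lTensor_exact C (f := N.subtype) (g := N.mkQ)
    (LinearMap.exact_subtype_mkQ N) N.mkQ_surjective
  rw [LinearMap.mem_range, ← Set.mem_range, ← hex z]
  constructor
  · intro h f
    rw [← Submodule.Quotient.mk_eq_zero, ← Submodule.mkQ_apply, ← contractFst_lTensor, h, map_zero]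
  · intro h
    refine eq_zero_of_contractFst fun f => ?_
    rw [contractFst_lTensor, Submodule.mkQ_apply, Submodule.Quotient.mk_eq_zero]
    exact h f

theorem mem_range_rTensor_iff (N : Submodule k M) (z : M ⊗[k] C) :
    z ∈ LinearMap.range (N.subtype.rTensor C) ↔ ∀ f : Dual k C, contractSnd M f z ∈ N := by
  have hex := rTensor_exact C (f := N.subtype) (g := N.mkQ)
    (LinearMap.exact_subtype_mkQ N) N.mkQ_surjective
  rw [LinearMap.mem_range, ← Set.mem_range, ← hex z]
  constructor
  · intro h f
    rw [← Submodule.Quotient.mk_eq_zero, ← Submodule.mkQ_apply, ← contractSnd_rTensor, h, map_zero]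
  · intro h
    refine eq_of_contractSnd fun f => ?_
    rw [contractSnd_rTensor, Submodule.mkQ_apply, map_zero, Submodule.Quotient.mk_eq_zero]
    exact h f

/-- The one-factor criterion is applied twice; the second use needs functionals on `V` to extend to
`M`. This is what identifies subcoalgebras with bistable subspaces. -/
theorem mem_range_map_subtype_iff (U : Submodule k C) (V : Submodule k M) (z : C ⊗[k] M) :
    z ∈ LinearMap.range (TensorProduct.map U.subtype V.subtype) ↔
      (∀ f : Dual k C, contractFst M f z ∈ V) ∧ ∀ g : Dual k M, contractSnd C g z ∈ U := by
  constructor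
  · rintro ⟨w, rfl⟩
    constructor
    · rw [← mem_range_lTensor_iff]
      refine ⟨U.subtype.rTensor V w, ?_⟩
      rw [← LinearMap.comp_apply, LinearMap.lTensor_comp_rTensor]
    · rw [← mem_range_rTensor_iff]
      refine ⟨V.subtype.lTensor U w, ?_⟩
      rw [← LinearMap.comp_apply, LinearMap.rTensor_comp_lTensor]
  · rintro ⟨h1, h2⟩
    obtain ⟨w, rfl⟩ := (mem_range_lTensor_iff V z).2 h1
    obtain ⟨w', rfl⟩ : w ∈ LinearMap.range (U.subtype.rTensor V) := by
      rw [mem_range_rTensor_iff]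
      intro g
      obtain ⟨g', hg'⟩ := LinearMap.exists_extend g
      have h := h2 g'
      have : contractSnd C g' (V.subtype.lTensor C w) = contractSnd C g w := by
        rw [← hg']
        clear h h2 h1
        induction w with
        | zero => simp
        | add x y hx hy => simp only [map_add, hx, hy]
        | tmul c m => simp
      rwa [this] at h
    refine ⟨w', ?_⟩
    rw [← LinearMap.comp_apply, LinearMap.lTensor_comp_rTensor]

theorem map_mkQ_eq_zero_iff (U : Submodule k C) (V : Submodule k M) (z : C ⊗[k] M) :
    TensorProduct.map U.mkQ V.mkQ z = 0 ↔ ∀ (f : Dual k C) (g : Dual k M),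
      (∀ y ∈ U, f y = 0) → (∀ y ∈ V, g y = 0) → f (contractSnd C g z) = 0 := by
  have key : ∀ (f : Dual k (C ⧸ U)) (g : Dual k (M ⧸ V)),
      g (contractFst _ f (TensorProduct.map U.mkQ V.mkQ z)) =
        (f ∘ₗ U.mkQ) (contractSnd C (g ∘ₗ V.mkQ) z) := by
    intro f g
    induction z with
    | zero => simp
    | add x y hx hy => simp only [map_add, hx, hy]
    | tmul c m => simp [mul_comm]
  constructor
  · intro h f g hf hg
    have hf' : U ≤ LinearMap.ker f := hf
    have hg' : V ≤ LinearMap.ker g := hg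
    have := key (U.liftQ f hf') (V.liftQ g hg')
    rw [h, map_zero, map_zero, Submodule.liftQ_mkQ, Submodule.liftQ_mkQ] at this
    exact this.symm
  · intro h
    refine eq_zero_of_contractFst fun f => eq_of_forall_dual (k := k) fun g => ?_
    rw [key, map_zero]
    refine h _ _ (fun y hy => ?_) fun y hy => ?_
    · simp [(Submodule.Quotient.mk_eq_zero U).2 hy]
    · simp [(Submodule.Quotient.mk_eq_zero V).2 hy]

theorem exists_finite_contractFst (z : C ⊗[k] M) :
    ∃ W : Submodule k M, FiniteDimensional k W ∧ ∀ f : Dual k C, contractFst M f z ∈ W := by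
  induction z with
  | zero => exact ⟨⊥, inferInstance, by simp⟩
  | add x y hx hy =>
    obtain ⟨W, hW, h⟩ := hx
    obtain ⟨W', hW', h'⟩ := hy
    exact ⟨W ⊔ W', inferInstance, fun f => by
      rw [map_add]; exact Submodule.add_mem_sup (h f) (h' f)⟩
  | tmul c m =>
    refine ⟨k ∙ m, inferInstance, fun f => ?_⟩
    rw [contractFst_tmul]
    exact Submodule.smul_mem _ _ (Submodule.mem_span_singleton_self m)

theorem exists_finite_contractSnd (z : M ⊗[k] C) :
    ∃ W : Submodule k M, FiniteDimensional k W ∧ ∀ f : Dual k C, contractSnd M f z ∈ W := by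
  simpa only [contractSnd_eq_contractFst_comm] using
    exists_finite_contractFst (TensorProduct.comm k M C z)

/-- Contractions of different factors commute; with coassociativity this makes coefficient maps
equivariant and the two dual actions commute. -/
theorem contractSnd_contractFst_assoc (f : Dual k C) (g : Dual k N) (z : (C ⊗[k] M) ⊗[k] N) :
    contractSnd M g (contractFst (M ⊗[k] N) f (TensorProduct.assoc k C M N z)) =
      contractFst M f (contractSnd (C ⊗[k] M) g z) := by
  induction z with
  | zero => simp
  | add x y hx hy => simp only [map_add, hx, hy]
  | tmul z n =>
    induction z with
    | zero => simp
    | add x y hx hy => simp only [TensorProduct.add_tmul, map_add, hx, hy]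
    | tmul c m =>
      rw [assoc_tmul, contractFst_tmul, map_smul, contractSnd_tmul, contractSnd_tmul, map_smul,
        contractFst_tmul, smul_comm]

end TensorProduct

open TensorProduct

/-! ### Comodules as modules over the dual. -/

namespace LeftComodule

variable {k C M : Type*} [Field k] [AddCommGroup C] [Module k C] [Coalgebra k C]
  [AddCommGroup M] [Module k M] [LeftComodule k C M]

variable (k C M) in
/-- The action of the dual of `C` on a left comodule. -/
def act : Dual k C →ₗ[k] M →ₗ[k] M where
  toFun f := contractFst M f ∘ₗ coact
  map_add' f g := by rw [contractFst_add, LinearMap.add_comp]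
  map_smul' r f := by rw [contractFst_smul, LinearMap.smul_comp]; rfl

variable (C) in
/-- The coefficient map of a left comodule attached to a functional. -/
def coeff (ξ : Dual k M) : M →ₗ[k] C := contractSnd C ξ ∘ₗ coact

theorem act_apply (f : Dual k C) (m : M) : act k C M f m = contractFst M f (coact m) := rfl

theorem coeff_apply (ξ : Dual k M) (m : M) : coeff C ξ m = contractSnd C ξ (coact m) := rfl

theorem apply_coeff (f : Dual k C) (ξ : Dual k M) (m : M) :
    f (coeff C ξ m) = ξ (act k C M f m) :=
  (apply_contractFst f ξ _).symm

theorem counit_coeff (ξ : Dual k M) (m : M) :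
    Coalgebra.counit (R := k) (coeff C ξ m) = ξ m := by
  rw [apply_coeff, act_apply, contractFst, LinearMap.comp_apply]
  have := LinearMap.congr_fun (counit_coact (k := k) (C := C) (M := M)) m
  simp only [LinearMap.comp_apply] at this
  rw [this]
  simp

theorem coeff_act (ξ : Dual k M) (f : Dual k C) (m : M) :
    coeff C ξ (act k C M f m) = act k C C f (coeff C ξ m) := by
  have := LinearMap.congr_fun (coassoc (k := k) (C := C) (M := M)) m
  simp only [LinearMap.comp_apply, LinearEquiv.coe_coe] at this
  rw [coeff_apply, act_apply, ← contractFst_lTensor, ← this, contractSnd_contractFst_assoc,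
    contractSnd_rTensor]
  rfl

theorem isSubcomodule_iff {N : Submodule k M} :
    IsSubcomodule k C N ↔ IsStable (act k C M) N := by
  rw [IsSubcomodule, Submodule.map_le_iff_le_comap]
  constructor
  · exact fun h f x hx => (mem_range_lTensor_iff N _).1 (h hx) f
  · exact fun h x hx => (mem_range_lTensor_iff N _).2 fun f => h f x hx

theorem isColinear_iff {N : Type*} [AddCommGroup N] [Module k N] [LeftComodule k C N]
    {φ : M →ₗ[k] N} :
    IsColinear k C φ ↔ ∀ f m, φ (act k C M f m) = act k C N f (φ m) := by
  constructor
  · intro h f m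
    have := LinearMap.congr_fun h m
    simp only [LinearMap.comp_apply] at this
    rw [act_apply, act_apply, this, contractFst_lTensor]
  · intro h
    ext m
    refine eq_of_contractFst fun f => ?_
    rw [LinearMap.comp_apply, LinearMap.comp_apply, contractFst_lTensor]
    exact (h f m).symm

theorem IsSimple.isSimpleStable (h : IsSimple k C M) : IsSimpleStable (act k C M) ⊤ where
  stable _ _ _ := trivial
  ne_bot := by have := h.1; exact top_ne_bot
  eq_bot_or_eq K hK _ := h.2 K (isSubcomodule_iff.2 hK)

end LeftComodule

namespace RightComodule

variable {k C M : Type*} [Field k] [AddCommGroup C] [Module k C] [Coalgebra k C]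
  [AddCommGroup M] [Module k M] [RightComodule k C M]

variable (k C M) in
/-- The action of the dual of `C` on a right comodule. -/
def act : Dual k C →ₗ[k] M →ₗ[k] M where
  toFun f := contractSnd M f ∘ₗ coact
  map_add' f g := by rw [contractSnd_add, LinearMap.add_comp]
  map_smul' r f := by rw [contractSnd_smul, LinearMap.smul_comp]; rfl

variable (C) in
/-- The coefficient map of a right comodule attached to a functional. -/
def coeff (ξ : Dual k M) : M →ₗ[k] C := contractFst C ξ ∘ₗ coact

theorem act_apply (f : Dual k C) (m : M) : act k C M f m = contractSnd M f (coact m) := rfl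

theorem coeff_apply (ξ : Dual k M) (m : M) : coeff C ξ m = contractFst C ξ (coact m) := rfl

theorem apply_coeff (f : Dual k C) (ξ : Dual k M) (m : M) :
    f (coeff C ξ m) = ξ (act k C M f m) :=
  apply_contractFst ξ f _

theorem counit_coeff (ξ : Dual k M) (m : M) :
    Coalgebra.counit (R := k) (coeff C ξ m) = ξ m := by
  rw [apply_coeff, act_apply, contractSnd, LinearMap.comp_apply]
  have := LinearMap.congr_fun (counit_coact (k := k) (C := C) (M := M)) m
  simp only [LinearMap.comp_apply] at this
  rw [this]
  simp

theorem coeff_act (ξ : Dual k M) (f : Dual k C) (m : M) :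
    coeff C ξ (act k C M f m) = act k C C f (coeff C ξ m) := by
  have := LinearMap.congr_fun (coassoc (k := k) (C := C) (M := M)) m
  simp only [LinearMap.comp_apply, LinearEquiv.coe_coe] at this
  rw [coeff_apply, act_apply, ← contractSnd_rTensor, ← contractSnd_contractFst_assoc, this,
    contractFst_lTensor]
  rfl

theorem isSubcomodule_iff {N : Submodule k M} :
    IsSubcomodule k C N ↔ IsStable (act k C M) N := by
  rw [IsSubcomodule, Submodule.map_le_iff_le_comap]
  constructor
  · exact fun h f x hx => (mem_range_rTensor_iff N _).1 (h hx) f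
  · exact fun h x hx => (mem_range_rTensor_iff N _).2 fun f => h f x hx

theorem isColinear_iff {N : Type*} [AddCommGroup N] [Module k N] [RightComodule k C N]
    {φ : M →ₗ[k] N} :
    IsColinear k C φ ↔ ∀ f m, φ (act k C M f m) = act k C N f (φ m) := by
  constructor
  · intro h f m
    have := LinearMap.congr_fun h m
    simp only [LinearMap.comp_apply] at this
    rw [act_apply, act_apply, this, contractSnd_rTensor]
  · intro h
    ext m
    refine eq_of_contractSnd fun f => ?_
    rw [LinearMap.comp_apply, LinearMap.comp_apply, contractSnd_rTensor]
    exact (h f m).symm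

theorem IsSimple.isSimpleStable (h : IsSimple k C M) : IsSimpleStable (act k C M) ⊤ where
  stable _ _ _ := trivial
  ne_bot := by have := h.1; exact top_ne_bot
  eq_bot_or_eq K hK _ := h.2 K (isSubcomodule_iff.2 hK)

end RightComodule

/-! ### Translation back to coalgebras and conclusion. -/

namespace Coalgebra

variable (k C : Type*) [Field k] [AddCommGroup C] [Module k C] [Coalgebra k C]

/-- The two actions of the dual of a coalgebra on the coalgebra. -/
def dualActions : DualActions k C where
  counit := counit
  left := LeftComodule.act k C C
  right := RightComodule.act k C C
  counit_left f x := RightComodule.counit_coeff (C := C) f x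
  counit_right f x := LeftComodule.counit_coeff (C := C) f x
  apply_right f g x := LeftComodule.apply_coeff f g x
  commute f g x := (LeftComodule.coeff_act (C := C) g f x).symm
  finite_left x := exists_finite_contractFst (comul x)
  finite_right x := exists_finite_contractSnd (comul x)

variable {k C}

theorem isSubcoalgebra_iff {E : Submodule k C} : IsSubcoalgebra E ↔
    IsStable (dualActions k C).left E ∧ IsStable (dualActions k C).right E := by
  rw [IsSubcoalgebra, Submodule.map_le_iff_le_comap]
  constructor
  · exact fun h => ⟨fun f x hx => ((mem_range_map_subtype_iff E E _).1 (h hx)).1 f,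
      fun f x hx => ((mem_range_map_subtype_iff E E _).1 (h hx)).2 f⟩
  · exact fun h x hx => (mem_range_map_subtype_iff E E _).2
      ⟨fun f => h.1 f x hx, fun f => h.2 f x hx⟩

theorem isSimpleSubcoalgebra_iff {S : Submodule k C} :
    IsSimpleSubcoalgebra S ↔ (dualActions k C).IsSimpleBistable S := by
  constructor
  · rintro ⟨h1, h2, h3⟩
    rw [isSubcoalgebra_iff] at h1
    exact ⟨h1.1, h1.2, h2, fun E hl hr => h3 E (isSubcoalgebra_iff.2 ⟨hl, hr⟩)⟩
  · rintro ⟨h1, h2, h3, h4⟩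
    exact ⟨isSubcoalgebra_iff.2 ⟨h1, h2⟩, h3, fun E hE =>
      h4 E (isSubcoalgebra_iff.1 hE).1 (isSubcoalgebra_iff.1 hE).2⟩

theorem coe_wedge (U V : Submodule k C) : (wedge U V : Set C) = (dualActions k C).wedge U V := by
  ext x
  rw [SetLike.mem_coe, wedge, LinearMap.mem_ker, LinearMap.comp_apply, map_mkQ_eq_zero_iff]
  rfl

/-- Exchanging the two actions turns right distributivity into left distributivity and swaps the
arguments of the wedge. Since the pair of simple subcoalgebras is arbitrary, either kind of
distributivity serves both sides. -/
theorem IsDistributive.wedge_subset (hC : IsDistributive k C) {S T : Submodule k C}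
    (hS : (dualActions k C).IsSimpleBistable S) (hT : (dualActions k C).IsSimpleBistable T)
    (hST : S ≠ T) : (dualActions k C).wedge S T ⊆ (S ⊔ T : Submodule k C) := by
  rcases hC with h | h
  · rw [sup_comm]
    refine DualActions.wedge_eq_sup_of_distributive (fun N K L hN hK hL => ?_) hT hS hST.symm
    exact h N K L (LeftComodule.isSubcomodule_iff.2 hN) (LeftComodule.isSubcomodule_iff.2 hK)
      (LeftComodule.isSubcomodule_iff.2 hL)
  · rw [← DualActions.symm_wedge]
    refine DualActions.wedge_eq_sup_of_distributive (fun N K L hN hK hL => ?_) hS.symm hT.symm hST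
    exact h N K L (RightComodule.isSubcomodule_iff.2 hN) (RightComodule.isSubcomodule_iff.2 hK)
      (RightComodule.isSubcomodule_iff.2 hL)

end Coalgebra

open Coalgebra in
/-- The dual action on a left comodule, as a right-handed action for the co-opposite coalgebra. -/
def LeftComodule.comoduleAction (k C M : Type*) [Field k] [AddCommGroup C] [Module k C]
    [Coalgebra k C] [AddCommGroup M] [Module k M] [LeftComodule k C M] :
    (dualActions k C).symm.ComoduleAction M where
  act := act k C M
  coeff := coeff C
  counit_coeff := counit_coeff
  apply_coeff := apply_coeff
  coeff_act := coeff_act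

open Coalgebra in
/-- The dual action on a right comodule. -/
def RightComodule.comoduleAction (k C M : Type*) [Field k] [AddCommGroup C] [Module k C]
    [Coalgebra k C] [AddCommGroup M] [Module k M] [RightComodule k C M] :
    (dualActions k C).ComoduleAction M where
  act := act k C M
  coeff := coeff C
  counit_coeff := counit_coeff
  apply_coeff := apply_coeff
  coeff_act := coeff_act

theorem mainTheorem12 (k : Type u) (C : Type v) [Field k] [AddCommGroup C] [Module k C]
    [Coalgebra k C] (hC : Coalgebra.IsDistributive k C) :
    (∀ S T : Coalgebra.QuiverVertex k C, S ≠ T → IsEmpty (S ⟶ T)) ∧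
    (∀ (S T : Type w) [AddCommGroup S] [Module k S] [LeftComodule k C S]
      [AddCommGroup T] [Module k T] [LeftComodule k C T],
      LeftComodule.IsSimple k C S → LeftComodule.IsSimple k C T →
        ¬ LeftComodule.Iso k C S T → ¬ LeftComodule.HasArrow k C S T) ∧
    (∀ (S T : Type w) [AddCommGroup S] [Module k S] [RightComodule k C S]
      [AddCommGroup T] [Module k T] [RightComodule k C T],
      RightComodule.IsSimple k C S → RightComodule.IsSimple k C T →
        ¬ RightComodule.Iso k C S T → ¬ RightComodule.HasArrow k C S T) := by
  refine ⟨fun S T hST => ⟨fun h => h.down ?_⟩, ?_, ?_⟩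
  · have hS := Coalgebra.isSimpleSubcoalgebra_iff.1 S.2
    have hT := Coalgebra.isSimpleSubcoalgebra_iff.1 T.2
    have hne : S.1 ≠ T.1 := fun h => hST (Subtype.ext h)
    refine SetLike.coe_injective (subset_antisymm ?_ ?_)
    · rw [Coalgebra.coe_wedge, sup_comm]
      exact hC.wedge_subset hT hS hne.symm
    · rw [Coalgebra.coe_wedge]
      exact fun x hx => DualActions.sup_le_wedge hS hT hx
  · rintro S T _ _ _ _ _ _ hS hT hST ⟨X, _, _, _, f, g, hX, hf, hg, hfi, hfg, hgs⟩
    refine hST ?_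
    obtain ⟨e, he⟩ := DualActions.ComoduleAction.exists_equiv (D := (Coalgebra.dualActions k C).symm)
      (fun U V hU hV hUV => by
        rw [DualActions.symm_wedge, sup_comm]
        exact hC.wedge_subset hV.symm hU.symm hUV.symm)
      (LeftComodule.comoduleAction k C S) (LeftComodule.comoduleAction k C X)
      (LeftComodule.comoduleAction k C T) hS.isSimpleStable hT.isSimpleStable
      (fun N K hN hK => hX.2 N K (LeftComodule.isSubcomodule_iff.2 hN)
        (LeftComodule.isSubcomodule_iff.2 hK))
      (LeftComodule.isColinear_iff.1 hf) (LeftComodule.isColinear_iff.1 hg) hfi hfg hgs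
    exact ⟨e, LeftComodule.isColinear_iff.2 he⟩
  · rintro S T _ _ _ _ _ _ hS hT hST ⟨X, _, _, _, f, g, hX, hf, hg, hfi, hfg, hgs⟩
    refine hST ?_
    obtain ⟨e, he⟩ := DualActions.ComoduleAction.exists_equiv
      (fun U V hU hV hUV => hC.wedge_subset hU hV hUV)
      (RightComodule.comoduleAction k C S) (RightComodule.comoduleAction k C X)
      (RightComodule.comoduleAction k C T) hS.isSimpleStable hT.isSimpleStable
      (fun N K hN hK => hX.2 N K (RightComodule.isSubcomodule_iff.2 hN)
        (RightComodule.isSubcomodule_iff.2 hK))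
      (RightComodule.isColinear_iff.1 hf) (RightComodule.isColinear_iff.1 hg) hfi hfg hgs
    exact ⟨e, RightComodule.isColinear_iff.2 he⟩
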